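/- **Model.** A *fully-parallel circuit* with $n$ inputs and $k$ outputs is laid out in the plane on a grid of unit squares (Thompson model). Each computational node occupies one square. Each wire joins two nodes and runs along side-adjacent squares that are free of other nodes; each side of a square is crossed by at most one wire (at most once), and wires may share a square only where they cross at a right angle. The nodes operate synchronously: in each clock cycle every wire carries one bit in each direction, and every node updates its memory and determines the bits it sends from its own memory and the bits arriving on its wires. The $n$ input symbols are injected at the start into $n$ distinct input nodes, and the $k$ output bits are read at the end from $k$ distinct output nodes. The area $A$ is the number of squares occupied by nodes and wires, $T$ is the number of clock cycles, and the energy is $E=AT$. Fix $\epsilon\in(0,1)$. A *decoding scheme* is a sequence of codes with block lengths $n_1<n_2<\cdots$, numbers of bits $k(n_1),k(n_2),\dots$ and encoding functions $\{0,1\}^{k(n)}\to\{0,1\}^{n}$, each with a fully-parallel decoding circuit with $n$ inputs and $k(n)$ outputs. Let $P_{\mathrm e}(n)$ be the block error probability of the decoder of block length $n$ when $k(n)$ independent fair bits are encoded, sent through $n$ uses of the binary erasure channel with erasure probability $\epsilon$, and the $n$ channel outputs (each a bit or an erasure) are the inputs of the decoder. The scheme is *polynomially-low-error* if for some $t>0$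 one has $P_{\mathrm e}(n)<n^{-t}$ for all sufficiently large block lengths $n$ of the scheme, and the limit $R=\lim_{n\to\infty}k(n)/n$ exists and is positive. **Statement.** Every polynomially-low-error decoding scheme has energy $E(n)\ge\Omega\left(n\sqrt{\ln n}\right)$ as $n\to\infty$ along the block lengths of the scheme. If a scheme attains this bound, i.e. $E(n)=\Theta\left(n\sqrt{\ln n}\right)$, then $T(n)\ge\Omega\left(\sqrt{\ln n}\right)$. -/

import Mathlib

open Filter Topology Asymptotics

/-- The grid of unit squares that tile the plane (a square is named by its integer coordinates);
two squares are adjacent when they share a side. -/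
def squareGrid : SimpleGraph (ℤ × ℤ) where
  Adj p q := |p.1 - q.1| + |p.2 - q.2| = 1
  symm := ⟨fun p q h => by rwa [abs_sub_comm q.1, abs_sub_comm q.2]⟩
  loopless := ⟨fun p h => by simp at h⟩

/-- The walk `p` goes straight through its `i`-th square (used for `0 < i < p.length`). -/
def IsStraightAt {a b : ℤ × ℤ} (p : squareGrid.Walk a b) (i : ℕ) : Prop :=
  p.getVert (i + 1) - p.getVert i = p.getVert i - p.getVert (i - 1)

/-- The planar layout of a circuit in the Thompson model, with wires of unit width.
Each node occupies one square. A wire joins two nodes and runs through squares that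
are free of nodes. A side of a square is crossed by at most one wire, so a node has at most four
wire ends; wires share a square only where they cross at a right angle, both running straight. -/
structure ThompsonLayout where
  numNodes : ℕ
  numWires : ℕ
  /-- the square that a node occupies -/
  place : Fin numNodes ↪ ℤ × ℤ
  /-- the node at the end `false`, respectively `true`, of a wire -/
  tip : Fin numWires → Bool → Fin numNodes
  /-- the squares that a wire visits, the squares of the two nodes included -/
  route : (w : Fin numWires) → squareGrid.Walk (place (tip w false)) (place (tip w true))
  route_not_nil : ∀ w, ¬ (route w).Nil
  route_isTrail : ∀ w, (route w).IsTrail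
  route_disjoint : ∀ w w', w ≠ w' → (route w).edges.Disjoint (route w').edges
  route_avoids_nodes : ∀ w i, 0 < i → i < (route w).length →
    (route w).getVert i ∉ Set.range place
  right_angle_crossing : ∀ w i w' j, 0 < i → i < (route w).length →
    0 < j → j < (route w').length → (route w).getVert i = (route w').getVert j →
    (w = w' ∧ i = j) ∨ (IsStraightAt (route w) i ∧ IsStraightAt (route w') j)

namespace ThompsonLayout

/-- The squares occupied by nodes and wires. -/
def occupied (L : ThompsonLayout) : Set (ℤ × ℤ) :=
  Set.range L.place ∪ {c | ∃ w, c ∈ (L.route w).support}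

/-- The circuit area: the number of occupied unit squares. -/
noncomputable def area (L : ThompsonLayout) : ℕ := L.occupied.ncard

end ThompsonLayout

/-- A fully-parallel circuit with `n` inputs and `k` outputs: a Thompson layout with nodes that
operate synchronously. Each input symbol (a channel output: a bit, or `none` for an erasure) is
injected at the start into an input node of its own, and each output bit appears at the end in
an output node of its own. In a clock cycle, each wire carries one bit in each direction.
A node sends, and updates its state, as a function of its own state and of the bits that
arrive on the wires attached to it. -/
structure FullyParallelCircuit (n k : ℕ) extends ThompsonLayout where
  /-- contents of the memory of a node -/
  State : Type
  input : Fin n ↪ Fin numNodes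
  output : Fin k ↪ Fin numNodes
  /-- initial state of a node that is not an input node -/
  start : Fin numNodes → State
  /-- initial state of an input node, given the injected symbol -/
  load : Fin n → Option Bool → State
  /-- the bit that the node at end `b` of wire `w` sends into this wire -/
  send : (w : Fin numWires) → (b : Bool) → State → Bool
  /-- the new state of a node, given its state and the bits arriving at its wire ends -/
  update : (v : Fin numNodes) → State →
    ({e : Fin numWires × Bool // tip e.1 e.2 = v} → Bool) → State
  /-- the output bit that an output node presents at the end -/
  read : Fin k → State → Bool
  /-- the number of clock cycles of the computation -/
  cycles : ℕ

namespace FullyParallelCircuit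

variable {n k : ℕ} (C : FullyParallelCircuit n k)

/-- The states of the nodes before the first clock cycle, on input `y`. -/
noncomputable def initial (y : Fin n → Option Bool) : Fin C.numNodes → C.State :=
  Function.extend C.input (fun i => C.load i (y i)) C.start

/-- One clock cycle: the bit arriving at an end of a wire is the one sent from its other end. -/
def cycle (s : Fin C.numNodes → C.State) : Fin C.numNodes → C.State := fun v =>
  C.update v (s v) (fun e => C.send e.1.1 (!e.1.2) (s (C.tip e.1.1 (!e.1.2))))

/-- The function computed by the circuit. -/
noncomputable def compute (y : Fin n → Option Bool) : Fin k → Bool := fun j =>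
  C.read j ((C.cycle^[C.cycles] (C.initial y)) (C.output j))

/-- The energy `A T` of the computation. -/
noncomputable def energy : ℝ := (C.area : ℝ) * (C.cycles : ℝ)

end FullyParallelCircuit

/-- Transition probabilities of the binary erasure channel with erasure probability `ε`
(`none` is the erasure symbol). -/
noncomputable def binaryErasureChannel (ε : ℝ) (x : Bool) : Option Bool → ℝ
  | none => ε
  | some b => if b = x then 1 - ε else 0

/-- Block error probability: `k` independent fair bits are encoded by `enc`, sent through `n`
independent uses of the binary erasure channel, and estimated by `dec` from the received word. -/
noncomputable def blockErrorProbability (ε : ℝ) {n k : ℕ}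
    (enc : (Fin k → Bool) → (Fin n → Bool)) (dec : (Fin n → Option Bool) → (Fin k → Bool)) : ℝ :=
  ∑ x : Fin k → Bool, (1 / 2 : ℝ) ^ k *
    ∑ y : Fin n → Option Bool,
      (∏ i, binaryErasureChannel ε (enc x i) (y i)) * (if dec y = x then 0 else 1)

/-- A fully-parallel decoding scheme: an infinite sequence of codes with increasing block lengths,
each with a fully-parallel decoding circuit. -/
structure DecodingScheme where
  blockLength : ℕ → ℕ
  blockLength_strictMono : StrictMono blockLength
  bitsDecoded : ℕ → ℕ
  encoder : (m : ℕ) → (Fin (bitsDecoded m) → Bool) → (Fin (blockLength m) → Bool)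
  decoder : (m : ℕ) → FullyParallelCircuit (blockLength m) (bitsDecoded m)

namespace DecodingScheme

variable (D : DecodingScheme)

/-- The block error probability of the `m`-th decoder of the scheme. -/
noncomputable def errorProbability (ε : ℝ) (m : ℕ) : ℝ :=
  blockErrorProbability ε (D.encoder m) (D.decoder m).compute

/-- `D` is an `f(n)`-decoding scheme. -/
def IsSchemeFor (ε : ℝ) (f : ℕ → ℝ) : Prop :=
  ∀ᶠ m in atTop, D.errorProbability ε m < f (D.blockLength m)

/-- The asymptotic rate exists and equals `R`. -/
def HasRate (R : ℝ) : Prop :=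
  Tendsto (fun m => (D.bitsDecoded m : ℝ) / (D.blockLength m : ℝ)) atTop (𝓝 R)

/-- Polynomially-low-error decoding schemes for the erasure channel. -/
def IsPolynomiallyLowError (ε : ℝ) : Prop :=
  (∃ t : ℝ, 0 < t ∧ D.IsSchemeFor ε (fun n => 1 / (n : ℝ) ^ t)) ∧
    ∃ R : ℝ, 0 < R ∧ D.HasRate R

/-- The energy of the `m`-th decoder of the scheme. -/
noncomputable def energy (m : ℕ) : ℝ := (D.decoder m).energy

/-- The number of clock cycles of the `m`-th decoder of the scheme. -/
def cycles (m : ℕ) : ℕ := (D.decoder m).cycles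

end DecodingScheme

/-! Let `T` be the cycles, `A` the area. If all inputs in a set of nodes are erased, its outputs
depend only on the bits that enter it through its boundary, at most `T` per incoming wire end. With
more outputs than such bits, the outputs miss at least half of their values, so the error
probability is at least `ε ^ m / 2`, where `m` counts the inputs in the set. Polynomially low error
excludes this for some `m` of order `log n` (`card_outputsIn_le`).

Hence for every partition of the nodes into classes with at most `m` inputs, `k ≤ 2 * T * (number of
crossing wires)`. Cut the plane into strips of width `S`, and each strip after every `m` inputs in
reading order. Averaged over shifts and delays, the cut sides number at most `A / S + n / m + S * n
/ m` (`outputs_mul_le`). The choice `S ≈ √(m * A / n)` gives `A * T ^ 2 ≥ c * k ^ 2 * m / n`, of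
order `n * log n` (`sq_outputs_mul_le`). Both claims follow: `(A * T) ^ 2 = A * (A * T ^ 2)` with `A
≥ n`, and `T = A * T ^ 2 / (A * T)`. -/

/-! ### Information entering a set of nodes -/

namespace FullyParallelCircuit

variable {n k : ℕ} (C : FullyParallelCircuit n k)

/-- The wire ends at which bits from outside arrive in the set `S` of nodes. -/
def incoming (S : Finset (Fin C.numNodes)) : Finset (Fin C.numWires × Bool) :=
  {e | C.tip e.1 e.2 ∈ S ∧ C.tip e.1 (!e.2) ∉ S}

/-- The outputs that are presented at the nodes of `S`. -/
def outputsIn (S : Finset (Fin C.numNodes)) : Finset (Fin k) := {j | C.output j ∈ S}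

/-- The inputs that are injected at the nodes of `S`. -/
def inputsIn (S : Finset (Fin C.numNodes)) : Finset (Fin n) := {i | C.input i ∈ S}

/-- The bit arriving at the wire end `e` in clock cycle `t`, on input `y`. -/
noncomputable def arriving (y : Fin n → Option Bool) (t : ℕ) (e : Fin C.numWires × Bool) : Bool :=
  C.send e.1 (!e.2) (C.cycle^[t] (C.initial y) (C.tip e.1 (!e.2)))

/-- Induction on time: a bit reaching a node of `S` comes either from inside `S`, where the states
agree, or through an incoming end, where the transcripts agree. -/
theorem iterate_cycle_eq_of_arriving_eq {S : Finset (Fin C.numNodes)} {y y' : Fin n → Option Bool}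
    (hy : ∀ i ∈ C.inputsIn S, y i = y' i) {T : ℕ}
    (h : ∀ t < T, ∀ e ∈ C.incoming S, C.arriving y t e = C.arriving y' t e) :
    ∀ t ≤ T, ∀ v ∈ S, C.cycle^[t] (C.initial y) v = C.cycle^[t] (C.initial y') v := by
  intro t
  induction t with
  | zero =>
    intro _ v hv
    by_cases hin : ∃ i, C.input i = v
    · obtain ⟨i, rfl⟩ := hin
      simp [initial, C.input.injective.extend_apply, hy i (by simpa [inputsIn] using hv)]
    · simp [initial, Function.extend_apply' _ _ _ hin]
  | succ t ih =>
    intro ht v hv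
    have ih := ih (by omega)
    rw [Function.iterate_succ_apply', Function.iterate_succ_apply', cycle, cycle, ih v hv]
    congr 1
    funext ⟨e, he⟩
    by_cases hout : C.tip e.1 (!e.2) ∈ S
    · simp only [ih _ hout]
    · exact h t ht e (by simp [incoming, he, hv, hout])

theorem card_image_compute_le (S : Finset (Fin C.numNodes)) :
    (Finset.image (fun y (j : C.outputsIn S) => C.compute y j)
      {y | ∀ i ∈ C.inputsIn S, y i = none}).card ≤ 2 ^ (C.cycles * (C.incoming S).card) := by
  classical
  set f := fun (y : Fin n → Option Bool) (j : C.outputsIn S) => C.compute y j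
  set Y : Finset (Fin n → Option Bool) := {y | ∀ i ∈ C.inputsIn S, y i = none}
  have hcard : (Finset.univ : Finset (Fin C.cycles → C.incoming S → Bool)).card =
      2 ^ (C.cycles * (C.incoming S).card) := by
    simp [← pow_mul, mul_comm]
  rw [← hcard]
  have hex : ∀ v ∈ Y.image f, ∃ y ∈ Y, f y = v := fun v hv => Finset.mem_image.1 hv
  -- One input word is chosen per output value; its boundary transcript then determines that value.
  choose! g hg hfg using hex
  refine Finset.card_le_card_of_injOn (fun v t e => C.arriving (g v) t e) (by simp) ?_
  intro v hv v' hv' heq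
  rw [← hfg v hv, ← hfg v' hv']
  funext ⟨j, hj⟩
  have h1 := (Finset.mem_filter.1 (hg v hv)).2
  have h2 := (Finset.mem_filter.1 (hg v' hv')).2
  have := C.iterate_cycle_eq_of_arriving_eq (S := S) (y := g v) (y' := g v') (T := C.cycles)
    (fun i hi => (h1 i hi).trans (h2 i hi).symm)
    (fun t ht e he => congrFun (congrFun heq ⟨t, ht⟩) ⟨e, he⟩) C.cycles le_rfl (C.output j)
    (by simpa [outputsIn] using hj)
  simp [f, compute, this]

end FullyParallelCircuit

/-! ### Error caused by erasing a set of inputs -/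

theorem binaryErasureChannel_nonneg {ε : ℝ} (h0 : 0 ≤ ε) (h1 : ε ≤ 1) (x : Bool) (z : Option Bool) :
    0 ≤ binaryErasureChannel ε x z := by
  rcases z with _ | b
  · exact h0
  · simp only [binaryErasureChannel]
    split_ifs <;> linarith

theorem sum_binaryErasureChannel (ε : ℝ) (x : Bool) :
    ∑ z, binaryErasureChannel ε x z = 1 := by
  cases x <;> simp [Fintype.sum_option, binaryErasureChannel]

theorem sum_prod_binaryErasureChannel_erased (ε : ℝ) {n : ℕ} (c : Fin n → Bool)
    (S : Finset (Fin n)) :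
    ∑ y : Fin n → Option Bool with ∀ i ∈ S, y i = none, ∏ i, binaryErasureChannel ε (c i) (y i) =
      ε ^ S.card := by
  classical
  have hset : ({y | ∀ i ∈ S, y i = none} : Finset (Fin n → Option Bool)) =
      Fintype.piFinset (fun i => if i ∈ S then {none} else Finset.univ) := by
    ext y
    simp only [Finset.mem_filter, Finset.mem_univ, true_and, Fintype.mem_piFinset]
    refine forall_congr' fun i => ?_
    by_cases h : i ∈ S <;> simp [h]
  rw [hset, ← Finset.prod_univ_sum, ← Finset.prod_const, ← Finset.prod_subset S.subset_univ]
  · exact Finset.prod_congr rfl fun i hi => by simp [hi, binaryErasureChannel]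
  · intro i _ hi
    simp only [hi, if_false]
    exact sum_binaryErasureChannel ε (c i)

/-- A word is its restriction to `J` together with its free coordinates off `J`. -/
theorem card_filter_restrict_mem_le {k : ℕ} (J : Finset (Fin k)) (V : Finset (J → Bool)) :
    (Finset.univ.filter fun x : Fin k → Bool => (fun j : J => x j) ∈ V).card * 2 ^ J.card ≤
      V.card * 2 ^ k := by
  classical
  have h : (Finset.univ.filter fun x : Fin k → Bool => (fun j : J => x j) ∈ V).card ≤
      (V ×ˢ (Finset.univ : Finset ({j // j ∉ J} → Bool))).card := by
    refine Finset.card_le_card_of_injOn (fun x => (fun j => x j, fun j => x j)) ?_ ?_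
    · intro x hx
      simpa using hx
    · intro x _ x' _ hxx
      funext j
      by_cases hj : j ∈ J
      · exact congrFun (congrArg Prod.fst hxx) ⟨j, hj⟩
      · exact congrFun (congrArg Prod.snd hxx) ⟨j, hj⟩
  have hk : (Finset.univ : Finset ({j // j ∉ J} → Bool)).card * 2 ^ J.card = 2 ^ k := by
    have : Fintype.card {j // j ∉ J} = k - J.card := by
      rw [Fintype.card_subtype_compl]; simp
    have hle : J.card ≤ k := by simpa using J.card_le_univ
    rw [Finset.card_univ, Fintype.card_fun, Fintype.card_bool, this, ← pow_add,
      Nat.sub_add_cancel hle]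
  calc _ ≤ (V ×ˢ (Finset.univ : Finset ({j // j ∉ J} → Bool))).card * 2 ^ J.card :=
        Nat.mul_le_mul_right _ h
    _ = _ := by rw [Finset.card_product, mul_assoc, hk]

/-- If the outputs in `J` take at most half of their conceivable values while the inputs in `S` are
erased, then an erasure of `S` causes an error with probability at least one half. -/
theorem le_blockErrorProbability {ε : ℝ} (h0 : 0 ≤ ε) (h1 : ε ≤ 1) {n k : ℕ}
    (enc : (Fin k → Bool) → (Fin n → Bool)) (dec : (Fin n → Option Bool) → (Fin k → Bool))
    (S : Finset (Fin n)) (J : Finset (Fin k)) (V : Finset (J → Bool))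
    (hV : ∀ y, (∀ i ∈ S, y i = none) → (fun j : J => dec y j) ∈ V)
    (hcard : 2 * V.card ≤ 2 ^ J.card) :
    ε ^ S.card / 2 ≤ blockErrorProbability ε enc dec := by
  classical
  have hnn : ∀ x : Fin k → Bool, ∀ y : Fin n → Option Bool,
      0 ≤ ∏ i, binaryErasureChannel ε (enc x i) (y i) := fun x y =>
    Finset.prod_nonneg fun i _ => binaryErasureChannel_nonneg h0 h1 _ _
  set B : Finset (Fin k → Bool) := Finset.univ.filter fun x => (fun j : J => x j) ∈ V
  have hB : 2 * B.card ≤ 2 ^ k := by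
    have h2 := card_filter_restrict_mem_le J V
    have h3 : 2 * B.card * 2 ^ J.card ≤ 2 ^ k * 2 ^ J.card := by
      calc 2 * B.card * 2 ^ J.card = 2 * (B.card * 2 ^ J.card) := by ring
        _ ≤ 2 * (V.card * 2 ^ k) := by gcongr
        _ = 2 ^ k * (2 * V.card) := by ring
        _ ≤ _ := by gcongr
    exact Nat.le_of_mul_le_mul_right h3 (by positivity)
  have hBc : (2 : ℝ) ^ k / 2 ≤ (Bᶜ.card : ℝ) := by
    have h4 : (B.card : ℝ) + Bᶜ.card = 2 ^ k := by
      have := B.card_add_card_compl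
      simp only [Fintype.card_fun, Fintype.card_bool, Fintype.card_fin] at this
      exact_mod_cast this
    have h5 : 2 * (B.card : ℝ) ≤ 2 ^ k := by exact_mod_cast hB
    linarith
  -- When `S` is erased the decoded word restricts into `V`, so a message outside `B` is never
  -- recovered.
  have key : ∀ x ∈ Bᶜ, ε ^ S.card ≤ ∑ y : Fin n → Option Bool,
      (∏ i, binaryErasureChannel ε (enc x i) (y i)) * (if dec y = x then 0 else 1) := by
    intro x hx
    rw [← sum_prod_binaryErasureChannel_erased ε (enc x) S]
    calc _ = ∑ y : Fin n → Option Bool with ∀ i ∈ S, y i = none,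
          (∏ i, binaryErasureChannel ε (enc x i) (y i)) * (if dec y = x then 0 else 1) := by
          refine Finset.sum_congr rfl fun y hy => ?_
          have : dec y ≠ x := by
            rintro rfl
            simp only [B, Finset.mem_compl, Finset.mem_filter, Finset.mem_univ, true_and] at hx
            exact hx (hV y (by simpa using hy))
          simp [this]
      _ ≤ _ := by
          refine Finset.sum_le_sum_of_subset_of_nonneg (Finset.filter_subset _ _) fun y _ _ => ?_
          exact mul_nonneg (hnn x y) (by split_ifs <;> norm_num)
  calc ε ^ S.card / 2 = (2 ^ k / 2) * ((1 / 2) ^ k * ε ^ S.card) := by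
        have : (2 : ℝ) ^ k * (1 / 2) ^ k = 1 := by rw [← mul_pow]; norm_num
        linear_combination (-(ε ^ S.card) / 2) * this
    _ ≤ Bᶜ.card * ((1 / 2) ^ k * ε ^ S.card) := by gcongr
    _ = ∑ x ∈ Bᶜ, (1 / 2 : ℝ) ^ k * ε ^ S.card := by simp
    _ ≤ ∑ x ∈ Bᶜ, (1 / 2 : ℝ) ^ k * ∑ y : Fin n → Option Bool,
      (∏ i, binaryErasureChannel ε (enc x i) (y i)) * (if dec y = x then 0 else 1) :=
        Finset.sum_le_sum fun x hx => mul_le_mul_of_nonneg_left (key x hx) (by positivity)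
    _ ≤ blockErrorProbability ε enc dec := by
        refine Finset.sum_le_sum_of_subset_of_nonneg (Finset.subset_univ _) fun x _ _ => ?_
        refine mul_nonneg (by positivity) (Finset.sum_nonneg fun y _ => ?_)
        exact mul_nonneg (hnn x y) (by split_ifs <;> norm_num)

/-! ### Outputs against crossing wires of a partition -/

namespace FullyParallelCircuit

variable {n k : ℕ} (C : FullyParallelCircuit n k)

/-- A low error probability forces the bits of the outputs in `S` to arrive from outside. -/
theorem card_outputsIn_le {ε : ℝ} (h0 : 0 ≤ ε) (h1 : ε ≤ 1)
    (enc : (Fin k → Bool) → (Fin n → Bool)) {m : ℕ}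
    (herr : blockErrorProbability ε enc C.compute < ε ^ m / 2)
    (S : Finset (Fin C.numNodes)) (hS : (C.inputsIn S).card ≤ m) :
    (C.outputsIn S).card ≤ C.cycles * (C.incoming S).card := by
  -- One output bit beyond the number of incoming bits already leaves half of the values
  -- unreachable.
  by_contra! hlt
  have h := le_blockErrorProbability h0 h1 enc C.compute (C.inputsIn S) (C.outputsIn S) _
    (fun y hy => Finset.mem_image_of_mem _ (by simpa using hy))
    ((Nat.mul_le_mul_left 2 (C.card_image_compute_le S)).trans
      ((pow_succ' 2 _).symm.le.trans (Nat.pow_le_pow_right (by norm_num) hlt)))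
  have := pow_le_pow_of_le_one h0 h1 hS
  linarith

/-- The wires that join nodes in different classes of the partition by `f`. -/
def crossingWires {α : Type*} [DecidableEq α] (f : Fin C.numNodes → α) : Finset (Fin C.numWires) :=
  {w | f (C.tip w false) ≠ f (C.tip w true)}

/-- The bound for one class is summed over all classes; a crossing wire is incoming at both of its
ends, whence the factor 2. -/
theorem outputs_le_of_partition {ε : ℝ} (h0 : 0 ≤ ε) (h1 : ε ≤ 1)
    (enc : (Fin k → Bool) → (Fin n → Bool)) {m : ℕ}
    (herr : blockErrorProbability ε enc C.compute < ε ^ m / 2)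
    {α : Type*} [DecidableEq α] (f : Fin C.numNodes → α)
    (hf : ∀ a, (Finset.univ.filter fun i => f (C.input i) = a).card ≤ m) :
    k ≤ 2 * C.cycles * (C.crossingWires f).card := by
  set P := Finset.univ.image f
  set N : α → Finset (Fin C.numNodes) := fun a => {v | f v = a}
  set X : Finset (Fin C.numWires × Bool) := {e | f (C.tip e.1 e.2) ≠ f (C.tip e.1 (!e.2))}
  have hX : X.card ≤ 2 * (C.crossingWires f).card := by
    calc X.card ≤ (C.crossingWires f ×ˢ (Finset.univ : Finset Bool)).card := by
          refine Finset.card_le_card fun ⟨w, b⟩ he => ?_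
          cases b <;> simp_all [X, crossingWires, eq_comm]
      _ = _ := by simp [mul_comm]
  have hsum : ∑ a ∈ P, (C.incoming (N a)).card = X.card := by
    rw [Finset.card_eq_sum_card_fiberwise (f := fun e => f (C.tip e.1 e.2)) (t := P)
      (fun e _ => by simp [P])]
    refine Finset.sum_congr rfl fun a _ => congrArg _ ?_
    ext e
    simp only [incoming, N, X, Finset.mem_filter, Finset.mem_univ, true_and]
    constructor <;> rintro ⟨h, h'⟩ <;> refine ⟨?_, ?_⟩ <;> grind
  calc k = (Finset.univ : Finset (Fin k)).card := by simp
    _ = ∑ a ∈ P, (C.outputsIn (N a)).card := by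
        rw [Finset.card_eq_sum_card_fiberwise (f := fun j => f (C.output j)) (t := P)
          (fun e _ => by simp [P])]
        simp [outputsIn, N]
    _ ≤ ∑ a ∈ P, C.cycles * (C.incoming (N a)).card :=
        Finset.sum_le_sum fun a _ => C.card_outputsIn_le h0 h1 enc herr _
          (by simpa [inputsIn, N] using hf a)
    _ = C.cycles * X.card := by rw [← Finset.mul_sum, hsum]
    _ ≤ C.cycles * (2 * (C.crossingWires f).card) := by gcongr
    _ = _ := by ring

end FullyParallelCircuit

/-! ### Crossing wires against sides of occupied squares -/

namespace ThompsonLayout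

variable (L : ThompsonLayout)

theorem occupied_finite : L.occupied.Finite := by
  refine (Set.finite_range _).union ?_
  have : {c | ∃ w, c ∈ (L.route w).support} = ⋃ w, {c | c ∈ (L.route w).support} := by
    ext; simp
  rw [this]
  exact Set.finite_iUnion fun w => List.finite_toSet _

theorem numNodes_le_area : L.numNodes ≤ L.area := by
  have h := Set.ncard_le_ncard (Set.subset_union_left : Set.range L.place ⊆ L.occupied)
    L.occupied_finite
  have hcard : (Set.range L.place).ncard = L.numNodes := by
    rw [← Set.image_univ, Set.ncard_image_of_injective _ L.place.injective, Set.ncard_univ,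
      Nat.card_eq_fintype_card, Fintype.card_fin]
  rwa [hcard] at h

/-- The occupied squares, as a finite set. -/
noncomputable def squares : Finset (ℤ × ℤ) := L.occupied_finite.toFinset

theorem card_squares : L.squares.card = L.area :=
  (Set.ncard_eq_toFinset_card _ L.occupied_finite).symm

end ThompsonLayout

theorem SimpleGraph.Walk.exists_edge_apply_ne {V : Type*} {G : SimpleGraph V} {α : Type*}
    (f : V → α) {a b : V} (p : G.Walk a b) (h : f a ≠ f b) :
    ∃ u v, s(u, v) ∈ p.edges ∧ f u ≠ f v := by
  induction p with
  | nil => exact absurd rfl h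
  | @cons u v w huv p ih =>
    by_cases h' : f u = f v
    · obtain ⟨x, y, hxy, hne⟩ := ih (h' ▸ h)
      exact ⟨x, y, by simp [hxy], hne⟩
    · exact ⟨u, v, by simp, h'⟩

theorem squareGrid_adj_cases {p q : ℤ × ℤ} (h : squareGrid.Adj p q) :
    q = (p.1 + 1, p.2) ∨ p = (q.1 + 1, q.2) ∨ q = (p.1, p.2 + 1) ∨ p = (q.1, q.2 + 1) := by
  obtain ⟨a, b⟩ := p
  obtain ⟨c, d⟩ := q
  simp only [squareGrid] at h
  simp only [Prod.mk.injEq]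
  rcases abs_cases (a - c) with h1 | h1 <;> rcases abs_cases (b - d) with h2 | h2 <;> omega

namespace ThompsonLayout

variable (L : ThompsonLayout)

/-- Distinct wires that leave a class of a partition of the plane do so through distinct sides. -/
theorem card_crossing_le {α : Type*} [DecidableEq α] (f : ℤ × ℤ → α) :
    (Finset.univ.filter fun w => f (L.place (L.tip w false)) ≠ f (L.place (L.tip w true))).card ≤
      (L.squares.filter fun p => f p ≠ f (p.1 + 1, p.2)).card +
      (L.squares.filter fun p => f p ≠ f (p.1, p.2 + 1)).card := by
  classical
  set W := Finset.univ.filter fun w => f (L.place (L.tip w false)) ≠ f (L.place (L.tip w true))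
  have hex : ∀ w ∈ W, ∃ e ∈ (L.route w).edges, ∃ u v, e = s(u, v) ∧ f u ≠ f v := by
    intro w hw
    obtain ⟨u, v, huv, hne⟩ := (L.route w).exists_edge_apply_ne f (Finset.mem_filter.1 hw).2
    exact ⟨_, huv, u, v, rfl, hne⟩
  choose! g hg hcross using hex
  have hocc : ∀ w, ∀ c ∈ (L.route w).support, c ∈ L.squares := fun w c hc =>
    L.occupied_finite.mem_toFinset.2 (Or.inr ⟨w, hc⟩)
  -- Each side is filed under its left or lower square, which is occupied because a wire runs
  -- through it.
  calc W.card ≤ ((L.squares.filter fun p => f p ≠ f (p.1 + 1, p.2)).image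
            (fun p => s(p, (p.1 + 1, p.2))) ∪
          (L.squares.filter fun p => f p ≠ f (p.1, p.2 + 1)).image
            (fun p => s(p, (p.1, p.2 + 1)))).card := by
        refine Finset.card_le_card_of_injOn g ?_ ?_
        · intro w hw
          obtain ⟨u, v, he, hne⟩ := hcross w hw
          have hmem := hg w hw
          rw [he] at hmem
          have hu := hocc w u ((L.route w).fst_mem_support_of_mem_edges hmem)
          have hv := hocc w v ((L.route w).snd_mem_support_of_mem_edges hmem)
          rw [Finset.mem_coe, he, Finset.mem_union, Finset.mem_image, Finset.mem_image]
          rcases squareGrid_adj_cases ((L.route w).adj_of_mem_edges hmem) with h | h | h | h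
          · exact Or.inl ⟨u, by simpa [hu, ← h] using hne, by rw [← h]⟩
          · exact Or.inl ⟨v, by simpa [hv, ← h] using hne.symm, by rw [← h, Sym2.eq_swap]⟩
          · exact Or.inr ⟨u, by simpa [hu, ← h] using hne, by rw [← h]⟩
          · exact Or.inr ⟨v, by simpa [hv, ← h] using hne.symm, by rw [← h, Sym2.eq_swap]⟩
        · intro w hw w' hw' heq
          by_contra hne
          exact L.route_disjoint w w' hne (hg w hw) (heq ▸ hg w' hw')
    _ ≤ _ := (Finset.card_union_le _ _).trans (add_le_add Finset.card_image_le Finset.card_image_le)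

end ThompsonLayout

/-! ### Cutting the plane into pieces with few inputs -/

/-- Reading order of the squares: row by row. -/
def RowLT (p q : ℤ × ℤ) : Prop := p.2 < q.2 ∨ p.2 = q.2 ∧ p.1 < q.1

instance : DecidableRel RowLT := fun _ _ => inferInstanceAs (Decidable (_ ∨ _))

/-- The vertical strip of width `S` that contains a square, the strips being shifted by `σ`. -/
def strip (S σ : ℕ) (p : ℤ × ℤ) : ℤ := (p.1 + σ) / S

/-- The number of squares of `Q` that precede `p` in its strip. -/
def stripRank (Q : Finset (ℤ × ℤ)) (S σ : ℕ) (p : ℤ × ℤ) : ℕ :=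
  (Q.filter fun q => strip S σ q = strip S σ p ∧ RowLT q p).card

/-- The strips are cut after every `m` squares of `Q`, with a delay. -/
def stripPiece (Q : Finset (ℤ × ℤ)) (m S σ o : ℕ) (p : ℤ × ℤ) : ℤ × ℕ :=
  (strip S σ p, (stripRank Q S σ p + o) / m)

theorem stripRank_lt {Q : Finset (ℤ × ℤ)} {S σ : ℕ} {p q : ℤ × ℤ} (hp : p ∈ Q)
    (hs : strip S σ p = strip S σ q) (h : RowLT p q) : stripRank Q S σ p < stripRank Q S σ q := by
  refine Finset.card_lt_card ⟨fun x hx => ?_, fun hsub => ?_⟩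
  · rw [Finset.mem_filter] at hx ⊢
    refine ⟨hx.1, hx.2.1.trans hs, ?_⟩
    have hxp := hx.2.2
    simp only [RowLT] at hxp h ⊢
    omega
  · have := (Finset.mem_filter.1 (hsub (Finset.mem_filter.2 ⟨hp, hs, h⟩))).2.2
    simp [RowLT] at this

/-- Ranks are distinct on the squares of `Q` in one strip, and a piece admits only a window of `m`
ranks. -/
theorem card_filter_stripPiece_le (Q : Finset (ℤ × ℤ)) {m : ℕ} (hm : 0 < m) (S σ o : ℕ)
    (a : ℤ × ℕ) : (Q.filter fun p => stripPiece Q m S σ o p = a).card ≤ m := by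
  calc _ ≤ (Finset.Ico (a.2 * m) (a.2 * m + m)).card := by
        refine Finset.card_le_card_of_injOn (fun p => stripRank Q S σ p + o) ?_ ?_
        · intro p hp
          have h : (stripRank Q S σ p + o) / m = a.2 :=
            congrArg Prod.snd (Finset.mem_filter.1 hp).2
          rw [Nat.div_eq_iff hm] at h
          simp only [Finset.coe_Ico, Set.mem_Ico]
          omega
        · intro p hp q hq heq
          have hp' := Finset.mem_filter.1 hp
          have hq' := Finset.mem_filter.1 hq
          have hs : strip S σ p = strip S σ q := congrArg Prod.fst (hp'.2.trans hq'.2.symm)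
          have heq : stripRank Q S σ p = stripRank Q S σ q := by simpa using heq
          by_contra hne
          have : RowLT p q ∨ RowLT q p := by
            simp only [RowLT]
            by_contra hc
            exact hne (Prod.ext (by omega) (by omega))
          rcases this with h | h
          · exact (stripRank_lt hp'.1 hs h).ne heq
          · exact (stripRank_lt hq'.1 hs.symm h).ne heq.symm
    _ = m := by simp

/-- Hermite's identity: passing to `r + 1` replaces the term `r / m` by `(r + m) / m = r / m + 1`.
-/
theorem sum_range_add_div (r : ℕ) {m : ℕ} (hm : 0 < m) :
    ∑ o ∈ Finset.range m, (r + o) / m = r := by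
  induction r with
  | zero =>
    refine Finset.sum_eq_zero fun o ho => ?_
    simpa using Nat.div_eq_of_lt (Finset.mem_range.1 ho)
  | succ r ih =>
    have h1 := Finset.sum_range_succ (fun o => (r + o) / m) m
    have h2 := Finset.sum_range_succ' (fun o => (r + o) / m) m
    rw [Nat.add_div_right _ hm] at h1
    have h3 : ∑ o ∈ Finset.range m, (r + 1 + o) / m = ∑ o ∈ Finset.range m, (r + (o + 1)) / m :=
      Finset.sum_congr rfl fun o _ => by rw [add_assoc, add_comm 1 o]
    simp only [add_zero] at h2
    omega

/-- The quotients increase by `r' - r` in total over all delays, and each separating delay uses up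
at least one. -/
theorem card_filter_add_div_ne_le {r r' : ℕ} (h : r ≤ r') {m : ℕ} (hm : 0 < m) :
    ((Finset.range m).filter fun o => (r + o) / m ≠ (r' + o) / m).card ≤ r' - r := by
  rw [Finset.card_filter]
  have h3 : ∑ o ∈ Finset.range m, ((r + o) / m + if (r + o) / m ≠ (r' + o) / m then 1 else 0) ≤
      ∑ o ∈ Finset.range m, (r' + o) / m := by
    refine Finset.sum_le_sum fun o _ => ?_
    have : (r + o) / m ≤ (r' + o) / m := Nat.div_le_div_right (by omega)
    split_ifs <;> omega
  rw [Finset.sum_add_distrib, sum_range_add_div r hm, sum_range_add_div r' hm] at h3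
  omega

/-- Two squares of one strip are separated by few of the delays. -/
theorem card_filter_stripPiece_ne_le (Q : Finset (ℤ × ℤ)) {m : ℕ} (hm : 0 < m) {S σ : ℕ}
    {p p' : ℤ × ℤ} (hs : strip S σ p = strip S σ p') (hlt : RowLT p p') :
    ((Finset.range m).filter fun o => stripPiece Q m S σ o p ≠ stripPiece Q m S σ o p').card ≤
      (Q.filter fun q => strip S σ q = strip S σ p ∧ RowLT q p' ∧ ¬ RowLT q p).card := by
  have hadd : stripRank Q S σ p' = stripRank Q S σ p +
      (Q.filter fun q => strip S σ q = strip S σ p ∧ RowLT q p' ∧ ¬ RowLT q p).card := by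
    rw [stripRank, stripRank, ← Finset.card_union_of_disjoint]
    · congr 1
      ext q
      simp only [Finset.mem_filter, Finset.mem_union, ← hs]
      have : RowLT q p → RowLT q p' := fun h => by simp only [RowLT] at *; omega
      tauto
    · rw [Finset.disjoint_filter]
      tauto
  have h := card_filter_add_div_ne_le (r := stripRank Q S σ p) (r' := stripRank Q S σ p')
    (by omega) hm
  have hset : ((Finset.range m).filter fun o => stripPiece Q m S σ o p ≠ stripPiece Q m S σ o p') =
      (Finset.range m).filter fun o =>
        (stripRank Q S σ p + o) / m ≠ (stripRank Q S σ p' + o) / m :=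
    Finset.filter_congr fun o _ => by simp [stripPiece, hs]
  rw [hset]
  omega

/-- A boundary right of `p` forces `S ∣ p.1 + σ + 1`, which fixes `σ` modulo `S`. -/
theorem card_filter_strip_ne_le (S : ℕ) (p : ℤ × ℤ) :
    ((Finset.range S).filter fun σ => strip S σ p ≠ strip S σ (p.1 + 1, p.2)).card ≤ 1 := by
  refine Finset.card_le_one.2 fun σ hσ σ' hσ' => ?_
  rw [Finset.mem_filter, Finset.mem_range, strip, strip] at hσ hσ'
  have hS : (0 : ℤ) < S := by omega
  have key : ∀ z : ℤ, z / S ≠ (z + 1) / S → (S : ℤ) ∣ z + 1 := by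
    intro z hz
    by_contra hd
    have := Int.emod_add_mul_ediv (z + 1) S
    have h1 := Int.emod_nonneg (z + 1) hS.ne'
    have h2 := Int.emod_lt_of_pos (z + 1) hS
    have h3 : (z + 1) % S ≠ 0 := fun h => hd (Int.dvd_of_emod_eq_zero h)
    refine hz ?_
    have h4 : 1 ≤ (z + 1) % S := by omega
    rw [Int.ediv_eq_iff_of_pos hS]
    constructor <;> linarith
  have h1 := key _ (by simpa [add_right_comm] using hσ.2)
  have h2 := key _ (by simpa [add_right_comm] using hσ'.2)
  have h3 : (S : ℤ) ∣ (σ : ℤ) - σ' := by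
    have := dvd_sub h1 h2
    rwa [show p.1 + (σ : ℤ) + 1 - (p.1 + σ' + 1) = σ - σ' by ring] at this
  have := Int.eq_zero_of_abs_lt_dvd h3 (by rw [abs_lt]; omega)
  omega

/-- The right sides cut, summed over all shifts and delays. -/
theorem sum_card_right_cut_le (Q A : Finset (ℤ × ℤ)) {m : ℕ} (hm : 0 < m) (S : ℕ) :
    ∑ σ ∈ Finset.range S, ∑ o ∈ Finset.range m,
      (A.filter fun p => stripPiece Q m S σ o p ≠ stripPiece Q m S σ o (p.1 + 1, p.2)).card ≤
      A.card * m + S * Q.card := by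
  -- A strip boundary may be cut for all `m` delays; otherwise only `p` itself lies between `p` and
  -- its right neighbour.
  have hp : ∀ σ, ∀ p, ((Finset.range m).filter fun o =>
      stripPiece Q m S σ o p ≠ stripPiece Q m S σ o (p.1 + 1, p.2)).card ≤
      (if strip S σ p ≠ strip S σ (p.1 + 1, p.2) then 1 else 0) * m +
        (if p ∈ Q then 1 else 0) := by
    intro σ p
    split_ifs with h1 h2 h2
    · exact (Finset.card_filter_le _ _).trans (by simp)
    · exact (Finset.card_filter_le _ _).trans (by simp)
    all_goals
      refine (card_filter_stripPiece_ne_le Q hm (not_not.1 h1) (by simp [RowLT])).trans ?_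
    · rw [zero_mul, zero_add]
      refine Finset.card_le_one.2 fun q hq q' hq' => ?_
      have h1 := (Finset.mem_filter.1 hq).2.2
      have h2 := (Finset.mem_filter.1 hq').2.2
      simp only [RowLT] at h1 h2
      exact Prod.ext (by omega) (by omega)
    · rw [zero_mul, zero_add, Nat.le_zero, Finset.card_eq_zero, Finset.filter_eq_empty_iff]
      intro q hq hc
      simp only [RowLT] at hc
      exact h2 ((Prod.ext (by omega) (by omega) : q = p) ▸ hq)
  calc _ = ∑ σ ∈ Finset.range S, ∑ p ∈ A, ((Finset.range m).filter fun o =>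
      stripPiece Q m S σ o p ≠ stripPiece Q m S σ o (p.1 + 1, p.2)).card := by
        refine Finset.sum_congr rfl fun σ _ => ?_
        simp only [Finset.card_filter]
        exact Finset.sum_comm
    _ ≤ ∑ σ ∈ Finset.range S, ∑ p ∈ A,
        ((if strip S σ p ≠ strip S σ (p.1 + 1, p.2) then 1 else 0) * m +
        (if p ∈ Q then 1 else 0)) :=
        Finset.sum_le_sum fun σ _ => Finset.sum_le_sum fun p _ => hp σ p
    _ = (∑ p ∈ A, ((Finset.range S).filter fun σ =>
          strip S σ p ≠ strip S σ (p.1 + 1, p.2)).card * m) +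
        S * (A.filter (· ∈ Q)).card := by
        simp only [Finset.sum_add_distrib, Finset.card_filter, Finset.sum_mul]
        rw [Finset.sum_comm]
        simp
    _ ≤ (∑ p ∈ A, 1 * m) + S * Q.card := by
        gcongr with p hp
        · exact card_filter_strip_ne_le S p
        · exact fun x hx => (Finset.mem_filter.1 hx).2
    _ = _ := by simp

/-- The upper sides cut, summed over all delays. -/
theorem sum_card_upper_cut_le (Q A : Finset (ℤ × ℤ)) {m : ℕ} (hm : 0 < m) {S : ℕ} (hS : 0 < S)
    (σ : ℕ) :
    ∑ o ∈ Finset.range m,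
      (A.filter fun p => stripPiece Q m S σ o p ≠ stripPiece Q m S σ o (p.1, p.2 + 1)).card ≤
      S * Q.card := by
  calc _ = ∑ p ∈ A, ((Finset.range m).filter fun o =>
      stripPiece Q m S σ o p ≠ stripPiece Q m S σ o (p.1, p.2 + 1)).card := by
        simp only [Finset.card_filter]
        exact Finset.sum_comm
    _ ≤ ∑ p ∈ A, (Q.filter fun q => strip S σ q = strip S σ p ∧ RowLT q (p.1, p.2 + 1) ∧
          ¬ RowLT q p).card :=
        Finset.sum_le_sum fun p _ => card_filter_stripPiece_ne_le Q hm rfl (by simp [RowLT])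
    _ = ∑ q ∈ Q, (A.filter fun p => strip S σ q = strip S σ p ∧ RowLT q (p.1, p.2 + 1) ∧
          ¬ RowLT q p).card := by
        simp only [Finset.card_filter]
        exact Finset.sum_comm
    -- A given `q` lies between `p` and its upper neighbour for at most one `p` in each of the `S`
    -- columns of its strip.
    _ ≤ ∑ q ∈ Q, S := by
        refine Finset.sum_le_sum fun q _ => ?_
        calc _ ≤ (Finset.Ico (strip S σ q * S - σ) (strip S σ q * S - σ + S)).card := by
              refine Finset.card_le_card_of_injOn Prod.fst ?_ ?_
              · intro p hp
                have h := (Finset.mem_filter.1 hp).2.1.symm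
                rw [strip, Int.ediv_eq_iff_of_pos (by exact_mod_cast hS)] at h
                simp only [Finset.coe_Ico, Set.mem_Ico]
                constructor <;> nlinarith
              · intro p hp p' hp' heq
                have h1 := (Finset.mem_filter.1 hp).2.2
                have h2 := (Finset.mem_filter.1 hp').2.2
                simp only [RowLT] at h1 h2
                exact Prod.ext heq (by omega)
          _ = S := by simp
    _ = _ := by simp [mul_comm]

/-! ### Averaging over the cuts -/

namespace FullyParallelCircuit

variable {n k : ℕ} (C : FullyParallelCircuit n k)

theorem inputs_le_area : n ≤ C.area := by
  have := Fintype.card_le_of_embedding C.input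
  simp only [Fintype.card_fin] at this
  exact this.trans C.numNodes_le_area

/-- The partition bound is summed over all `S * m` pairs of shift and delay, which avoids choosing a
best pair. -/
theorem outputs_mul_le {ε : ℝ} (h0 : 0 ≤ ε) (h1 : ε ≤ 1)
    (enc : (Fin k → Bool) → (Fin n → Bool)) {m : ℕ} (hm : 0 < m)
    (herr : blockErrorProbability ε enc C.compute < ε ^ m / 2) {S : ℕ} (hS : 0 < S) :
    k * S * m ≤ 2 * C.cycles * (C.area * m + S * n + S * (S * n)) := by
  classical
  set Q : Finset (ℤ × ℤ) := Finset.univ.image fun i => C.place (C.input i)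
  have hinj : Function.Injective fun i => C.place (C.input i) :=
    C.place.injective.comp C.input.injective
  have hQ : Q.card = n := by rw [Finset.card_image_of_injective _ hinj]; simp
  have hk : ∀ σ o, k ≤ 2 * C.cycles *
      ((C.squares.filter fun p => stripPiece Q m S σ o p ≠ stripPiece Q m S σ o (p.1 + 1, p.2)).card +
      (C.squares.filter fun p =>
        stripPiece Q m S σ o p ≠ stripPiece Q m S σ o (p.1, p.2 + 1)).card) := by
    intro σ o
    refine (C.outputs_le_of_partition h0 h1 enc herr (fun v => stripPiece Q m S σ o (C.place v))
      fun a => ?_).trans (Nat.mul_le_mul_left _ (C.card_crossing_le _))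
    refine le_trans ?_ (card_filter_stripPiece_le Q hm S σ o a)
    refine Finset.card_le_card_of_injOn (fun i => C.place (C.input i)) ?_ hinj.injOn
    intro i hi
    simpa [Q] using hi
  calc k * S * m = ∑ σ ∈ Finset.range S, ∑ o ∈ Finset.range m, k := by simp; ring
    _ ≤ ∑ σ ∈ Finset.range S, ∑ o ∈ Finset.range m, 2 * C.cycles *
      ((C.squares.filter fun p => stripPiece Q m S σ o p ≠ stripPiece Q m S σ o (p.1 + 1, p.2)).card +
      (C.squares.filter fun p =>
        stripPiece Q m S σ o p ≠ stripPiece Q m S σ o (p.1, p.2 + 1)).card) :=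
        Finset.sum_le_sum fun σ _ => Finset.sum_le_sum fun o _ => hk σ o
    _ = 2 * C.cycles * ((∑ σ ∈ Finset.range S, ∑ o ∈ Finset.range m,
      (C.squares.filter fun p =>
        stripPiece Q m S σ o p ≠ stripPiece Q m S σ o (p.1 + 1, p.2)).card) +
      ∑ σ ∈ Finset.range S, ∑ o ∈ Finset.range m, (C.squares.filter fun p =>
        stripPiece Q m S σ o p ≠ stripPiece Q m S σ o (p.1, p.2 + 1)).card) := by
        simp only [← Finset.sum_add_distrib]
        simp only [Finset.mul_sum]
    _ ≤ 2 * C.cycles * ((C.squares.card * m + S * Q.card) + ∑ σ ∈ Finset.range S, S * Q.card) :=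
        Nat.mul_le_mul_left _ (add_le_add (sum_card_right_cut_le Q C.squares hm S)
          (Finset.sum_le_sum fun σ _ => sum_card_upper_cut_le Q C.squares hm hS σ))
    _ = _ := by simp [hQ, C.card_squares]

/-- The `A T ^ 2` bound. -/
theorem sq_outputs_mul_le {ε : ℝ} (h0 : 0 ≤ ε) (h1 : ε ≤ 1)
    (enc : (Fin k → Bool) → (Fin n → Bool)) (hn : 0 < n) {m : ℕ} (hm : 0 < m)
    (herr : blockErrorProbability ε enc C.compute < ε ^ m / 2) :
    (k : ℝ) ^ 2 * m ≤ 196 * (n * (C.area * C.cycles ^ 2)) := by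
  have hn' : (0 : ℝ) < n := by exact_mod_cast hn
  have hm' : (1 : ℝ) ≤ m := by exact_mod_cast hm
  have hA : (n : ℝ) ≤ C.area := by exact_mod_cast C.inputs_le_area
  set A : ℝ := (C.area : ℝ)
  set T : ℝ := (C.cycles : ℝ)
  have hT : 0 ≤ T := by positivity
  -- This width balances `A / S` against `S * n / m`; `A ≥ n` makes it at least 1, so rounding up
  -- costs only a constant.
  set x : ℝ := √(m * A / n)
  have hxx : x ^ 2 * n = m * A := by
    rw [Real.sq_sqrt (by positivity)]; field_simp
  have hx1 : 1 ≤ x := by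
    rw [Real.one_le_sqrt, le_div_iff₀ hn']
    nlinarith
  set S : ℕ := ⌈x⌉₊
  have hxS : x ≤ S := Nat.le_ceil x
  have hSx : (S : ℝ) < x + 1 := Nat.ceil_lt_add_one (by linarith)
  have hS : 0 < S := Nat.ceil_pos.2 (by linarith)
  have h : (k : ℝ) * S * m ≤ 2 * T * (A * m + S * n + S * (S * n)) := by
    have := (Nat.cast_le (α := ℝ)).2 (C.outputs_mul_le h0 h1 enc hm herr hS)
    push_cast at this
    exact this
  -- Here `14 = 2 * (1 + 6)`, the 6 coming from `(x + 1) * (x + 2) ≤ 6 * x ^ 2` for `x ≥ 1`.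
  have h2 : (k : ℝ) * x * m ≤ 14 * T * A * m := by
    have hS2 : (S : ℝ) * (S + 1) ≤ 6 * x ^ 2 := by nlinarith
    have hSn : (S : ℝ) * n + S * (S * n) ≤ 6 * (m * A) := by nlinarith
    calc (k : ℝ) * x * m ≤ k * S * m := by gcongr
      _ ≤ 2 * T * (A * m + S * n + S * (S * n)) := h
      _ ≤ 2 * T * (A * m + 6 * (m * A)) := by
          refine mul_le_mul_of_nonneg_left ?_ (by positivity)
          linarith
      _ = _ := by ring
  have h3 : (k : ℝ) * x ≤ 14 * T * A := le_of_mul_le_mul_right h2 (by linarith)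
  have h4 : ((k : ℝ) * x) ^ 2 ≤ (14 * T * A) ^ 2 := by gcongr
  have hApos : 0 < A := by linarith
  refine le_of_mul_le_mul_right (a := A) ?_ hApos
  calc (k : ℝ) ^ 2 * m * A = (k * x) ^ 2 * n := by rw [mul_pow]; linear_combination (-(k:ℝ)^2) * hxx
    _ ≤ (14 * T * A) ^ 2 * n := by gcongr
    _ = _ := by ring

end FullyParallelCircuit

/-! ### Asymptotics -/

/-- One factor `n ^ (-t / 2)` is at most the power of `ε`, the other at most `1 / 2`. -/
theorem rpow_neg_le_pow_floor {ε t : ℝ} (h0 : 0 < ε) (h1 : ε < 1) (ht : 0 < t) {n : ℕ} (hn : 0 < n)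
    (hlarge : 1 ≤ t / 2 * Real.log n) :
    1 / (n : ℝ) ^ t ≤ ε ^ ⌊t / (2 * -Real.log ε) * Real.log n⌋₊ / 2 := by
  have hn' : (0 : ℝ) < n := by exact_mod_cast hn
  have hL : 0 < -Real.log ε := neg_pos.2 (Real.log_neg h0 h1)
  have hne : Real.log ε ≠ 0 := (Real.log_neg h0 h1).ne
  set l := Real.log n
  set M : ℕ := ⌊t / (2 * -Real.log ε) * l⌋₊
  have hl : 0 < l := by
    by_contra! hc
    nlinarith
  have hM : (M : ℝ) ≤ t / (2 * -Real.log ε) * l := Nat.floor_le (by positivity)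
  have hM' : M * -Real.log ε ≤ t / 2 * l := by
    calc M * -Real.log ε ≤ t / (2 * -Real.log ε) * l * -Real.log ε := by gcongr
      _ = _ := by field_simp
  have hpow : ε ^ M = Real.exp (M * Real.log ε) := by
    rw [Real.exp_nat_mul, Real.exp_log h0]
  have hrpow : 1 / (n : ℝ) ^ t = Real.exp (-(t / 2 * l)) * Real.exp (-(t / 2 * l)) := by
    rw [Real.rpow_def_of_pos hn', ← Real.exp_add, one_div, ← Real.exp_neg]
    congr 1
    ring
  have h2 : Real.exp (-(t / 2 * l)) ≤ 1 / 2 := by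
    rw [Real.exp_neg, one_div]
    refine inv_anti₀ (by norm_num) ?_
    linarith [Real.add_one_le_exp (t / 2 * l)]
  rw [hrpow, hpow, div_eq_mul_one_div (Real.exp _)]
  refine mul_le_mul (Real.exp_le_exp.2 (by linarith)) h2 (Real.exp_pos _).le (Real.exp_pos _).le

namespace DecodingScheme

variable {D : DecodingScheme}

theorem IsPolynomiallyLowError.exists_le_area_mul_sq {ε : ℝ} (h0 : 0 < ε) (h1 : ε < 1)
    (hD : D.IsPolynomiallyLowError ε) :
    ∃ c : ℝ, 0 < c ∧ ∀ᶠ j in atTop,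
      c * (D.blockLength j * Real.log (D.blockLength j)) ≤
        (D.decoder j).area * (D.cycles j : ℝ) ^ 2 := by
  obtain ⟨⟨t, ht, herr⟩, R, hR, hrate⟩ := hD
  have hL : 0 < -Real.log ε := neg_pos.2 (Real.log_neg h0 h1)
  have hlog : Tendsto (fun j => Real.log (D.blockLength j)) atTop atTop :=
    Real.tendsto_log_atTop.comp
      (tendsto_natCast_atTop_atTop.comp D.blockLength_strictMono.tendsto_atTop)
  set a := t / (2 * -Real.log ε)
  have ha : 0 < a := by positivity
  -- `1568 = 196 * 8`: replacing `R` by `R / 2` costs 4 after squaring, and the floor costs 2.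
  refine ⟨R ^ 2 * a / 1568, by positivity, ?_⟩
  filter_upwards [herr, hrate.eventually (lt_mem_nhds (half_lt_self hR)),
    D.blockLength_strictMono.tendsto_atTop.eventually_gt_atTop 0,
    (hlog.const_mul_atTop (half_pos ht)).eventually_ge_atTop 1,
    (hlog.const_mul_atTop ha).eventually_ge_atTop 2] with j herr hrate hn hl1 hl2
  set n := D.blockLength j
  have hn' : (0 : ℝ) < n := by exact_mod_cast hn
  set M := ⌊a * Real.log n⌋₊
  have hM : 0 < M := Nat.floor_pos.2 (by linarith)
  have hM2 : a * Real.log n / 2 ≤ M := by linarith [Nat.lt_floor_add_one (a * Real.log n)]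
  have h := (D.decoder j).sq_outputs_mul_le h0.le h1.le (D.encoder j) hn hM
    (herr.trans_le (rpow_neg_le_pow_floor h0 h1 ht hn hl1))
  have hk : R / 2 * n ≤ D.bitsDecoded j := ((lt_div_iff₀ hn').1 hrate).le
  have h2 : (R / 2 * n) ^ 2 * (a * Real.log n / 2) ≤ (D.bitsDecoded j : ℝ) ^ 2 * M := by
    gcongr
  refine le_of_mul_le_mul_left (a := 196 * (n : ℝ)) ?_ (by positivity)
  calc _ = (R / 2 * n) ^ 2 * (a * Real.log n / 2) := by ring
    _ ≤ _ := h2.trans h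
    _ = _ := by rw [cycles]; ring

end DecodingScheme

theorem mainTheorem5 (ε : ℝ) (hε_pos : 0 < ε) (hε_lt : ε < 1) (D : DecodingScheme)
    (hD : D.IsPolynomiallyLowError ε) :
    ((fun m => (D.blockLength m : ℝ) * √(Real.log (D.blockLength m))) =O[atTop] D.energy) ∧
    (D.energy =Θ[atTop] (fun m => (D.blockLength m : ℝ) * √(Real.log (D.blockLength m))) →
      (fun m => √(Real.log (D.blockLength m))) =O[atTop] (fun m => (D.cycles m : ℝ))) := by
  obtain ⟨c, hc, hAT⟩ := hD.exists_le_area_mul_sq hε_pos hε_lt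
  have henergy : ∀ j, D.energy j = (D.decoder j).area * (D.cycles j : ℝ) := fun j => rfl
  have hlog : ∀ j, 0 ≤ Real.log (D.blockLength j) := fun j => Real.log_natCast_nonneg _
  constructor
  · refine IsBigO.of_bound (√c)⁻¹ ?_
    filter_upwards [hAT] with j hj
    have hA : (D.blockLength j : ℝ) ≤ (D.decoder j).area := by
      exact_mod_cast (D.decoder j).inputs_le_area
    have hE : 0 ≤ D.energy j := by rw [henergy]; positivity
    rw [Real.norm_of_nonneg (by positivity), Real.norm_of_nonneg hE,
      ← div_eq_inv_mul, le_div_iff₀ (by positivity)]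
    -- Squared, the energy is `A * (A * T ^ 2)`, and both factors are bounded below.
    refine le_of_sq_le_sq ?_ hE
    rw [mul_pow, mul_pow, Real.sq_sqrt (hlog j), Real.sq_sqrt hc.le, henergy]
    calc (D.blockLength j : ℝ) ^ 2 * Real.log (D.blockLength j) * c =
          D.blockLength j * (c * (D.blockLength j * Real.log (D.blockLength j))) := by ring
      _ ≤ (D.decoder j).area * ((D.decoder j).area * (D.cycles j : ℝ) ^ 2) := by gcongr
      _ = _ := by ring
  · intro hΘ
    obtain ⟨B, hB, hbound⟩ := hΘ.1.exists_pos
    refine IsBigO.of_bound (B / c) ?_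
    filter_upwards [hAT, hbound.bound,
      D.blockLength_strictMono.tendsto_atTop.eventually_gt_atTop 1] with j hj hEj hn
    have hn' : (1 : ℝ) < D.blockLength j := by exact_mod_cast hn
    set l := Real.log (D.blockLength j)
    have hl : 0 < √l := Real.sqrt_pos.2 (Real.log_pos hn')
    have hE : 0 ≤ D.energy j := by rw [henergy]; positivity
    rw [Real.norm_of_nonneg hE, Real.norm_of_nonneg (by positivity)] at hEj
    rw [Real.norm_of_nonneg hl.le, Real.norm_of_nonneg (by positivity), div_mul_eq_mul_div,
      le_div_iff₀ hc]
    refine le_of_mul_le_mul_right (a := D.blockLength j * √l) ?_ (by positivity)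
    -- The bound on `A * T ^ 2 = E * T` is divided by the upper bound on `E`.
    calc √l * c * (D.blockLength j * √l) = c * (D.blockLength j * √l ^ 2) := by ring
      _ = c * (D.blockLength j * l) := by rw [Real.sq_sqrt (hlog j)]
      _ ≤ (D.decoder j).area * (D.cycles j : ℝ) ^ 2 := hj
      _ = D.energy j * D.cycles j := by rw [henergy]; ring
      _ ≤ B * (D.blockLength j * √l) * D.cycles j := by gcongr
      _ = _ := by ring
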